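/- For every integer $n\ge 1$ let $U_1^{(n)},U_2^{(n)},\dots$ be independent random variables with the uniform distribution on $\{1,2,\dots,n\}$. On some probability space let $U_1,U_2,\dots$ be independent random variables with the uniform distribution on $[0,1]$, and let $\mathcal G_k(p)$, for $k\in\mathbb N=\{1,2,\dots\}$ and $p$ prime, be mutually independent random variables with values in $\{0,1,2,\dots\}$ and $\mathbb P\{\mathcal G_k(p)\ge j\}=p^{-j}$ for all integers $j\ge 0$; assume that the sequence $(U_j)_{j\ge1}$ is independent of the family $(\mathcal G_k(p))_{k,p}$. Then, almost surely, the series over all primes $$\sum_p \log p\cdot\Big(\max_{1\le k\le m}\mathcal G_k(p)-\sum_{k=1}^m\mathcal G_k(p)\Big)$$ converges absolutely for every $m\in\mathbb N$, and, as $n\to\infty$, $$\Big(\log\operatorname{lcm}(U_1^{(n)},\dots,U_m^{(n)})-m\log n\Big)_{m\in\mathbb N}\ \longrightarrow\ \Big(\sum_{j=1}^m\log U_j+\sum_p\log p\cdot\Big(\max_{1\le k\le m}\mathcal G_k(p)-\sum_{k=1}^m\mathcal G_k(p)\Big)\Big)_{m\in\mathbb N}$$ in distribution in $\mathbb R^{\mathbb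 N}$ endowed with the product topology. -/

import Mathlib

open Filter MeasureTheory ProbabilityTheory Finset

open scoped Topology ENNReal NNReal

/-! Writing `v_p` for the exponent of `p`, `log lcm(U_1, …, U_m) - m log n` equals `∑ log (U_j / n)`
plus the sum over primes of `log p * (max_k v_p(U_k) - ∑_k v_p(U_k))`. So it is the same functional
`logLcm` of sizes and prime exponents that defines the limit. Joint convergence of sizes and
exponents is a count. The event that `U ≤ e^{-c} n` and `p ^ a_p ∣ U` for `p ∈ F` has probability
`⌊⌊e^{-c} n⌋ / ∏ p ^ a_p⌋ / n`, which tends to `e^{-c} ∏ p ^ (-a_p)`; sizes and exponents thus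
become independent (`tendsto_measureReal_le_sizeExponents`). With sizes coded as `-log` in `ℝ≥0`,
these events are survival events in a product of half-lines, and they determine weak convergence
(`tendstoInDistribution_of_tendsto_measureReal_le`). Restricted to finitely many primes the
functional is continuous. The remaining primes are negligible in mean, uniformly in `n`: sum minus
maximum is at most the sum of pairwise minima, each minimum has mean at most `2 / p ^ 2`, and `∑ log
p / p ^ 2` converges. Then `tendstoInDistribution_pi_of_lintegral_edist_le` removes the restriction.
-/

/-! ### Weak convergence from survival functions. -/

/-- Convergence of measures on a π-system carries over to the differences `A \ ⋃ B` of a member and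
a finite union of members; if these contain arbitrarily small neighbourhoods of every point, then
the measures converge weakly. -/
lemma IsPiSystem.tendsto_probabilityMeasure_of_sdiff {E ι : Type*} [MeasurableSpace E]
    [TopologicalSpace E] [SecondCountableTopology E] [OpensMeasurableSpace E]
    {S : Set (Set E)} (hS : IsPiSystem S) {μ : ι → ProbabilityMeasure E} {ν : ProbabilityMeasure E}
    {l : Filter ι} [l.IsCountablyGenerated] (hmeas : ∀ s ∈ S, MeasurableSet s)
    (hnhds : ∀ u : Set E, IsOpen u → ∀ x ∈ u, ∃ A ∈ S, ∃ T : Finset (Set E), (∀ B ∈ T, B ∈ S) ∧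
      A \ (⋃ B ∈ T, B) ∈ 𝓝 x ∧ A \ (⋃ B ∈ T, B) ⊆ u)
    (hlim : ∀ s ∈ S, Tendsto (fun i ↦ (μ i : Measure E).real s) l (𝓝 ((ν : Measure E).real s))) :
    Tendsto μ l (𝓝 ν) := by
  classical
  let S' : Set (Set E) := {C | ∃ A ∈ S, ∃ T : Finset (Set E), (∀ B ∈ T, B ∈ S) ∧
    C = A \ (⋃ B ∈ T, B)}
  have hS' : IsPiSystem S' := by
    rintro _ ⟨A, hA, T, hT, rfl⟩ _ ⟨A', hA', T', hT', rfl⟩ hne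
    refine ⟨A ∩ A', hS A hA A' hA' (hne.mono fun x hx ↦ ⟨hx.1.1, hx.2.1⟩), T ∪ T', ?_, ?_⟩
    · intro B hB
      rcases Finset.mem_union.1 hB with h | h
      exacts [hT B h, hT' B h]
    · ext x
      simp only [Set.mem_inter_iff, Set.mem_sdiff, Set.mem_iUnion, Finset.mem_union]
      grind
  have hU (T : Finset (Set E)) (hT : ∀ B ∈ T, B ∈ S) : MeasurableSet (⋃ B ∈ T, B) :=
    T.measurableSet_biUnion fun B hB ↦ hmeas B (hT B hB)
  refine hS'.tendsto_probabilityMeasure_of_tendsto_of_mem ?_ ?_ ?_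
  · rintro _ ⟨A, hA, T, hT, rfl⟩
    exact (hmeas A hA).diff (hU T hT)
  · intro u hu x hx
    obtain ⟨A, hA, T, hT, h1, h2⟩ := hnhds u hu x hx
    exact ⟨_, ⟨A, hA, T, hT, rfl⟩, h1, h2⟩
  · rintro _ ⟨A, hA, T, hT, rfl⟩
    -- A difference of measures of two finite unions; by inclusion-exclusion these involve only
    -- intersections of members of `S`.
    have key (ρ : ProbabilityMeasure E) : (ρ : Measure E).real (A \ ⋃ B ∈ T, B) =
        (ρ : Measure E).real (⋃ C ∈ insert A T, C) - (ρ : Measure E).real (⋃ B ∈ T, B) := by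
      rw [measureReal_sdiff' (hU T hT) (measure_ne_top _ _) (measure_ne_top _ _),
        Finset.set_biUnion_insert]
    have hlim' : Tendsto (fun i ↦ (μ i : Measure E).real (A \ ⋃ B ∈ T, B)) l
        (𝓝 ((ν : Measure E).real (A \ ⋃ B ∈ T, B))) := by
      rw [key ν]
      refine Tendsto.congr (fun i ↦ (key (μ i)).symm) (Tendsto.sub ?_ ?_)
      · refine hS.tendsto_measureReal_biUnion (fun B hB ↦ ?_) hmeas hlim
        rcases Finset.mem_insert.1 hB with rfl | h
        exacts [hA, hT B h]
      · exact hS.tendsto_measureReal_biUnion hT hmeas hlim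
    simpa using hlim'

/-- Convergence in distribution in `ℝ≥0 ^ I`, for countable `I`, follows from the convergence of
the joint survival functions. -/
lemma tendstoInDistribution_of_tendsto_measureReal_le {I ι Ω' : Type*} [Countable I] {Ω : ι → Type*}
    [∀ n, MeasurableSpace (Ω n)] {P : (n : ι) → Measure (Ω n)} [∀ n, IsProbabilityMeasure (P n)]
    [MeasurableSpace Ω'] {P' : Measure Ω'} [IsProbabilityMeasure P']
    {l : Filter ι} [l.IsCountablyGenerated] {Y : (n : ι) → Ω n → I → ℝ≥0} {Z : Ω' → I → ℝ≥0}
    (hY : ∀ n, Measurable (Y n)) (hZ : Measurable Z)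
    (h : ∀ x : I →₀ ℝ≥0, Tendsto (fun n ↦ (P n).real {ω | ∀ i, x i ≤ Y n ω i}) l
      (𝓝 (P'.real {ω | ∀ i, x i ≤ Z ω i}))) :
    TendstoInDistribution Y l Z P P' := by
  classical
  refine ⟨fun n ↦ (hY n).aemeasurable, hZ.aemeasurable, ?_⟩
  let C (x : I →₀ ℝ≥0) : Set (I → ℝ≥0) := {y | ∀ i, x i ≤ y i}
  have hC (x : I →₀ ℝ≥0) : MeasurableSet (C x) := by
    have : C x = Set.Ici (x : I → ℝ≥0) := by ext y; simp [C, Pi.le_def]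
    exact this ▸ isClosed_Ici.measurableSet
  refine IsPiSystem.tendsto_probabilityMeasure_of_sdiff (S := Set.range C) ?_ ?_ ?_ ?_
  · rintro _ ⟨x, rfl⟩ _ ⟨y, rfl⟩ -
    refine ⟨x ⊔ y, ?_⟩
    ext z
    simp [C, forall_and]
  · rintro _ ⟨x, rfl⟩
    exact hC x
  · intro u hu y hy
    obtain ⟨J, t, ht, hJ⟩ := isOpen_pi_iff.1 hu y hy
    have hint (i : I) : ∃ a b : ℝ≥0, y i < b ∧ Set.Ici a ∈ 𝓝 (y i) ∧
        (i ∈ J → Set.Ico a b ⊆ t i) := by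
      by_cases hi : i ∈ J
      · have hti : t i ∈ 𝓝 (y i) := (ht i hi).1.mem_nhds (ht i hi).2
        obtain ⟨b, hb, hb'⟩ := exists_Ico_subset_of_mem_nhds hti ⟨y i + 1, by simp⟩
        -- At the end point 0 there is no room below, but `Set.Ici 0` is already a neighbourhood.
        rcases eq_or_ne (y i) 0 with h0 | h0
        · refine ⟨0, b, hb, by simp, fun _ ↦ by simpa [h0] using hb'⟩
        · obtain ⟨c, hc, hc'⟩ := exists_Ioc_subset_of_mem_nhds hti ⟨0, pos_iff_ne_zero.2 h0⟩
          obtain ⟨a, hca, hay⟩ := exists_between hc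
          refine ⟨a, b, hb, Ici_mem_nhds hay, fun _ z hz ↦ ?_⟩
          rcases le_total z (y i) with h | h
          exacts [hc' ⟨hca.trans_le hz.1, h⟩, hb' ⟨h, hz.2⟩]
      · exact ⟨0, y i + 1, by simp, by simp, fun h ↦ absurd h hi⟩
    choose a b hyb ha hab using hint
    -- The bound 0 outside `J` is no condition in `ℝ≥0`.
    let x : I →₀ ℝ≥0 := Finsupp.onFinset J (fun i ↦ if i ∈ J then a i else 0) (by simp; tauto)
    have hx (z : I → ℝ≥0) : z ∈ C x ↔ ∀ i ∈ J, a i ≤ z i := by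
      refine forall_congr' fun i ↦ ?_
      by_cases hi : i ∈ J <;> simp [x, hi]
    have hs (i : I) (z : I → ℝ≥0) : z ∈ C (Finsupp.single i (b i)) ↔ b i ≤ z i := by
      refine ⟨fun h ↦ by simpa using h i, fun h j ↦ ?_⟩
      rcases eq_or_ne i j with rfl | hj
      · simpa using h
      · simp [hj]
    have hdiff : C x \ (⋃ B ∈ J.image fun i ↦ C (Finsupp.single i (b i)), B)
        = {z | ∀ i ∈ J, z i ∈ Set.Ico (a i) (b i)} := by
      ext z
      simp only [Set.mem_sdiff, hx, Finset.set_biUnion_finset_image, Set.mem_iUnion, hs,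
        Set.mem_ofPred_eq, Set.mem_Ico]
      push Not
      exact ⟨fun h i hi ↦ ⟨h.1 i hi, h.2 i hi⟩, fun h ↦ ⟨fun i hi ↦ (h i hi).1,
        fun i hi ↦ (h i hi).2⟩⟩
    refine ⟨C x, ⟨x, rfl⟩, J.image fun i ↦ C (Finsupp.single i (b i)), ?_, ?_, ?_⟩
    · simp only [Finset.mem_image]
      rintro _ ⟨i, -, rfl⟩
      exact ⟨_, rfl⟩
    · rw [hdiff]
      refine (Filter.eventually_all_finset J).2 fun i _ ↦ ?_
      have : ∀ᶠ w in 𝓝 (y i), w ∈ Set.Ico (a i) (b i) := by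
        filter_upwards [ha i, Iio_mem_nhds (hyb i)] with w h1 h2 using ⟨h1, h2⟩
      exact (continuous_apply i).tendsto y this
    · rw [hdiff]
      exact fun z hz ↦ hJ fun i hi ↦ hab i hi (hz i hi)
  · rintro _ ⟨x, rfl⟩
    have := h x
    simp only [ProbabilityMeasure.coe_mk]
    simp_rw [map_measureReal_apply (hY _) (hC x), map_measureReal_apply hZ (hC x)]
    exact this

/-! ### Convergence in distribution by approximation in mean. -/

/-- The expectations of a bounded Lipschitz function of two random variables are close if the
random variables are close in mean. -/
lemma edist_integral_comp_le {E Ω : Type*} [PseudoEMetricSpace E] [MeasurableSpace E]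
    [BorelSpace E] [SecondCountableTopology E] [MeasurableSpace Ω] {P : Measure Ω}
    [IsProbabilityMeasure P] {f : E → ℝ} {C : ℝ} (hC : ∀ x y, dist (f x) (f y) ≤ C) {L : ℝ≥0}
    (hL : LipschitzWith L f) {A B : Ω → E} (hA : AEMeasurable A P) (hB : AEMeasurable B P)
    {d : ℝ≥0∞} (hAB : ∫⁻ ω, edist (A ω) (B ω) ∂P ≤ d) :
    edist (∫ ω, f (A ω) ∂P) (∫ ω, f (B ω) ∂P) ≤ L * d := by
  have hf : Continuous f := hL.continuous
  have hint {A : Ω → E} (hA : AEMeasurable A P) : Integrable (fun ω ↦ f (A ω)) P := by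
    obtain ⟨ω₀⟩ : Nonempty Ω := P.nonempty_of_neZero
    refine Integrable.of_bound (by fun_prop) (‖f (A ω₀)‖ + C) (ae_of_all _ fun a ↦ ?_)
    rw [← sub_le_iff_le_add']
    exact (abs_sub_abs_le_abs_sub _ _).trans (hC _ _)
  rw [edist_eq_enorm_sub, ← integral_sub (hint hA) (hint hB)]
  calc _ ≤ ∫⁻ ω, ‖f (A ω) - f (B ω)‖ₑ ∂P := enorm_integral_le_lintegral_enorm _
    _ ≤ ∫⁻ ω, L * edist (A ω) (B ω) ∂P := lintegral_mono fun ω ↦ by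
        rw [← edist_eq_enorm_sub]; exact hL _ _
    _ = L * ∫⁻ ω, edist (A ω) (B ω) ∂P := lintegral_const_mul' _ _ (by simp)
    _ ≤ L * d := by gcongr

/-- If `X n` is approximated in mean by `W k n`, uniformly in `n`, and `Z` by `W' k`, and if
`W k n` tends to `W' k` in distribution for every `k`, then `X n` tends to `Z` in distribution. -/
lemma tendstoInDistribution_of_lintegral_edist_le {E ι κ Ω' : Type*} {Ω : ι → Type*}
    [PseudoEMetricSpace E] [MeasurableSpace E] [BorelSpace E] [SecondCountableTopology E]
    [∀ n, MeasurableSpace (Ω n)] {P : (n : ι) → Measure (Ω n)} [∀ n, IsProbabilityMeasure (P n)]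
    [MeasurableSpace Ω'] {P' : Measure Ω'} [IsProbabilityMeasure P']
    {l : Filter ι} [l.IsCountablyGenerated] {l' : Filter κ} [l'.NeBot]
    {X : (n : ι) → Ω n → E} {Z : Ω' → E} {W : κ → (n : ι) → Ω n → E} {W' : κ → Ω' → E}
    (hX : ∀ n, AEMeasurable (X n) (P n)) (hZ : AEMeasurable Z P')
    (hW : ∀ k, TendstoInDistribution (W k) l (W' k) P P') {δ : κ → ℝ≥0∞}
    (hδ : Tendsto δ l' (𝓝 0)) (hXW : ∀ k n, ∫⁻ ω, edist (X n ω) (W k n ω) ∂P n ≤ δ k)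
    (hZW : ∀ k, ∫⁻ ω, edist (Z ω) (W' k ω) ∂P' ≤ δ k) :
    TendstoInDistribution X l Z P P' := by
  refine ⟨hX, hZ, ?_⟩
  refine tendsto_iff_forall_lipschitz_integral_tendsto.2 ?_
  rintro f ⟨C, hC⟩ ⟨L, hL⟩
  have hf : Continuous f := hL.continuous
  simp only [ProbabilityMeasure.coe_mk]
  rw [integral_map hZ (by fun_prop)]
  simp_rw [fun n ↦ integral_map (hX n) (f := f) (by fun_prop)]
  rw [EMetric.tendsto_nhds]
  intro ε hε
  have hLδ : Tendsto (fun k ↦ L * δ k) l' (𝓝 0) := by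
    simpa using ENNReal.Tendsto.const_mul hδ (a := L) (by simp)
  obtain ⟨k, hk⟩ := (hLδ.eventually_lt_const (ENNReal.div_pos hε.ne' (by simp : (3 : ℝ≥0∞) ≠ ⊤))).exists
  have hmid := (tendsto_iff_forall_lipschitz_integral_tendsto.1 (hW k).tendsto) f ⟨C, hC⟩ ⟨L, hL⟩
  simp only [ProbabilityMeasure.coe_mk] at hmid
  rw [integral_map (hW k).aemeasurable_limit (by fun_prop)] at hmid
  simp_rw [fun n ↦ integral_map ((hW k).forall_aemeasurable n) (f := f) (by fun_prop)] at hmid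
  filter_upwards [EMetric.tendsto_nhds.1 hmid (ε / 3) (ENNReal.div_pos hε.ne' (by simp))] with n hn
  calc edist (∫ ω, f (X n ω) ∂P n) (∫ ω, f (Z ω) ∂P')
      ≤ edist (∫ ω, f (X n ω) ∂P n) (∫ ω, f (W k n ω) ∂P n)
        + edist (∫ ω, f (W k n ω) ∂P n) (∫ ω, f (W' k ω) ∂P')
        + edist (∫ ω, f (W' k ω) ∂P') (∫ ω, f (Z ω) ∂P') := edist_triangle4 _ _ _ _
    _ < ε / 3 + ε / 3 + ε / 3 := by
        refine ENNReal.add_lt_add (ENNReal.add_lt_add ?_ hn) ?_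
        · exact (edist_integral_comp_le hC hL (hX n) ((hW k).forall_aemeasurable n) (hXW k n)).trans_lt hk
        · rw [edist_comm]
          exact (edist_integral_comp_le hC hL hZ (hW k).aemeasurable_limit (hZW k)).trans_lt hk
    _ = ε := ENNReal.add_thirds ε

open scoped PiCountable in
/-- The mean distance of two random elements of a countable product is controlled by the mean
distances of their coordinates. -/
lemma PiCountable.lintegral_edist_le {E I Ω : Type*} [Encodable I] [PseudoEMetricSpace E]
    [MeasurableSpace E] [BorelSpace E] [SecondCountableTopology E] [MeasurableSpace Ω]
    {P : Measure Ω} [IsProbabilityMeasure P] {A B : Ω → I → E} (hA : AEMeasurable A P)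
    (hB : AEMeasurable B P) {d : I → ℝ≥0∞} (hAB : ∀ i, ∫⁻ ω, edist (A ω i) (B ω i) ∂P ≤ d i) :
    ∫⁻ ω, edist (A ω) (B ω) ∂P ≤ ∑' i, min (2⁻¹ ^ Encodable.encode i) (d i) := by
  have hm (i : I) : AEMeasurable (fun ω ↦ edist (A ω i) (B ω i)) P :=
    ((measurable_pi_apply i).comp_aemeasurable hA).edist
      ((measurable_pi_apply i).comp_aemeasurable hB)
  simp_rw [PiCountable.edist_eq_tsum]
  rw [lintegral_tsum fun i ↦ aemeasurable_const.min (hm i)]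
  refine ENNReal.tsum_le_tsum fun i ↦ le_min ?_ ?_
  · calc _ ≤ ∫⁻ _, 2⁻¹ ^ Encodable.encode i ∂P := lintegral_mono fun ω ↦ min_le_left _ _
      _ = _ := by simp
  · exact (lintegral_mono fun ω ↦ min_le_right _ _).trans (hAB i)

/-- Version of `tendstoInDistribution_of_lintegral_edist_le` for a countable product: the mean
approximation is only required in each coordinate. -/
lemma tendstoInDistribution_pi_of_lintegral_edist_le {E I ι κ Ω' : Type*} {Ω : ι → Type*}
    [Countable I] [PseudoEMetricSpace E] [MeasurableSpace E] [BorelSpace E]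
    [SecondCountableTopology E]
    [∀ n, MeasurableSpace (Ω n)] {P : (n : ι) → Measure (Ω n)} [∀ n, IsProbabilityMeasure (P n)]
    [MeasurableSpace Ω'] {P' : Measure Ω'} [IsProbabilityMeasure P']
    {l : Filter ι} [l.IsCountablyGenerated] {l' : Filter κ} [l'.NeBot] [l'.IsCountablyGenerated]
    {X : (n : ι) → Ω n → I → E} {Z : Ω' → I → E} {W : κ → (n : ι) → Ω n → I → E}
    {W' : κ → Ω' → I → E}
    (hX : ∀ n, AEMeasurable (X n) (P n)) (hZ : AEMeasurable Z P')
    (hW : ∀ k, TendstoInDistribution (W k) l (W' k) P P') {δ : κ → I → ℝ≥0∞}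
    (hδ : ∀ i, Tendsto (fun k ↦ δ k i) l' (𝓝 0))
    (hXW : ∀ k n i, ∫⁻ ω, edist (X n ω i) (W k n ω i) ∂P n ≤ δ k i)
    (hZW : ∀ k i, ∫⁻ ω, edist (Z ω i) (W' k ω i) ∂P' ≤ δ k i) :
    TendstoInDistribution X l Z P P' := by
  have := Encodable.ofCountable I
  let : PseudoEMetricSpace (I → E) := PiCountable.pseudoEMetricSpace
  refine tendstoInDistribution_of_lintegral_edist_le (l' := l') hX hZ hW
    (δ := fun k ↦ ∑' i, min (2⁻¹ ^ Encodable.encode i) (δ k i)) ?_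
    (fun k n ↦ PiCountable.lintegral_edist_le (hX n) ((hW k).forall_aemeasurable n) (hXW k n))
    (fun k ↦ PiCountable.lintegral_edist_le hZ (hW k).aemeasurable_limit (hZW k))
  -- The series is an integral for the counting measure; the weights `2⁻¹ ^ encode i` dominate it,
  -- so convergence in each coordinate suffices.
  let : MeasurableSpace I := ⊤
  have := tendsto_lintegral_filter_of_dominated_convergence (μ := (Measure.count : Measure I))
    (l := l') (F := fun k i ↦ min (2⁻¹ ^ Encodable.encode i) (δ k i)) (f := fun _ ↦ 0)
    (fun i ↦ 2⁻¹ ^ Encodable.encode i) (.of_forall fun _ ↦ measurable_from_top)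
    (.of_forall fun _ ↦ .of_forall fun _ ↦ min_le_left _ _) ?_
    (.of_forall fun i ↦ by simpa using tendsto_const_nhds.min (hδ i))
  · simpa [lintegral_count] using this
  · rw [lintegral_count]
    exact (ENNReal.tsum_geometric_two_encode_le_two.trans_lt (by simp)).ne

/-! ### Mean excess of a sum of exponents over their maximum. -/

/-- Induction through `max a b + min a b = a + b`: minimum distributes over the running maximum, so
its minimum with the new term is at most a sum of pairwise minima. -/
lemma sum_range_le_sup_add_sum_min (f : ℕ → ℕ) (m : ℕ) :
    ∑ k ∈ range m, f k ≤
      (range m).sup f + ∑ j ∈ range m, ∑ i ∈ range j, min (f i) (f j) := by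
  induction m with
  | zero => simp
  | succ m ih =>
    rw [sum_range_succ, sum_range_succ _ m, range_add_one, sup_insert]
    have h : min ((range m).sup f) (f m) ≤ ∑ i ∈ range m, min (f i) (f m) := by
      refine (Finset.sup_inf_distrib_right _ _ _).trans_le ?_
      exact Finset.sup_le fun i hi ↦ single_le_sum_of_canonicallyOrdered
        (f := fun i ↦ min (f i) (f m)) hi
    have h' := max_add_min ((range m).sup f) (f m)
    change _ ≤ max (f m) ((range m).sup f) + _
    rw [max_comm]
    omega

lemma abs_sup_sub_sum_le_sum_min (f : ℕ → ℕ) (m : ℕ) :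
    |(((range m).sup f : ℕ) : ℝ) - ∑ k ∈ range m, (f k : ℝ)| ≤
      ((∑ j ∈ range m, ∑ i ∈ range j, min (f i) (f j) : ℕ) : ℝ) := by
  have h1 : (range m).sup f ≤ ∑ k ∈ range m, f k :=
    Finset.sup_le fun i hi ↦ single_le_sum_of_canonicallyOrdered hi
  have h2 := sum_range_le_sup_add_sum_min f m
  rw [abs_sub_comm, abs_of_nonneg (by rw [sub_nonneg]; exact_mod_cast h1), sub_le_iff_le_add']
  exact_mod_cast h2

/-- The minimum of two independent variables with geometric tails has a mean of the order of the
square of the ratio. -/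
lemma lintegral_min_le_of_geometric_tail {Ω : Type*} [MeasurableSpace Ω] {P : Measure Ω}
    {X Y : Ω → ℕ} (hX : Measurable X) (hY : Measurable Y) (hXY : IndepFun X Y P) {q : ℝ≥0∞}
    (hq : q ≤ 2⁻¹) (hXq : ∀ a, P {ω | a ≤ X ω} ≤ q ^ a) (hYq : ∀ a, P {ω | a ≤ Y ω} ≤ q ^ a) :
    ∫⁻ ω, ((min (X ω) (Y ω) : ℕ) : ℝ≥0∞) ∂P ≤ 2 * q ^ 2 := by
  have hset (a : ℕ) : {ω | a + 1 ≤ min (X ω) (Y ω)} =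
      X ⁻¹' Set.Ici (a + 1) ∩ Y ⁻¹' Set.Ici (a + 1) := by
    ext ω; simp
  have hmeas (a : ℕ) : MeasurableSet {ω | a + 1 ≤ min (X ω) (Y ω)} := by
    rw [hset]
    exact (hX measurableSet_Ici).inter (hY measurableSet_Ici)
  -- Layer-cake formula: `k` counts the `a` with `a + 1 ≤ k`.
  have hcount (k : ℕ) : (k : ℝ≥0∞) = ∑' a : ℕ, (Set.Ici (a + 1)).indicator 1 k := by
    rw [tsum_eq_sum (s := range k)]
    · rw [Finset.sum_congr rfl (g := fun _ ↦ 1)]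
      · simp
      · intro a ha
        simp [Set.indicator, Nat.succ_le_of_lt (Finset.mem_range.1 ha)]
    · intro a ha
      simp only [Finset.mem_range, not_lt] at ha
      simp [Set.indicator]
      omega
  calc ∫⁻ ω, ((min (X ω) (Y ω) : ℕ) : ℝ≥0∞) ∂P
      = ∫⁻ ω, ∑' a : ℕ, {ω | a + 1 ≤ min (X ω) (Y ω)}.indicator 1 ω ∂P := by
        refine lintegral_congr fun ω ↦ ?_
        rw [hcount]
        rfl
    _ = ∑' a : ℕ, P {ω | a + 1 ≤ min (X ω) (Y ω)} := by
        rw [lintegral_tsum fun a ↦ (measurable_one.indicator (hmeas a)).aemeasurable]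
        simp_rw [lintegral_indicator_one (hmeas _)]
    -- Independence gives `q ^ (2 * (a + 1))`. One factor `q ^ a` is bounded by `2⁻¹ ^ a`, the other
    -- by 1, leaving a geometric series with sum 2.
    _ ≤ ∑' a : ℕ, q ^ 2 * 2⁻¹ ^ a := by
        refine ENNReal.tsum_le_tsum fun a ↦ ?_
        rw [hset, hXY.measure_inter_preimage_eq_mul _ _ measurableSet_Ici measurableSet_Ici]
        calc _ ≤ q ^ (a + 1) * q ^ (a + 1) := mul_le_mul' (hXq _) (hYq _)
          _ = q ^ 2 * (q ^ a * q ^ a) := by ring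
          _ ≤ q ^ 2 * (2⁻¹ ^ a * 1) := by
              gcongr
              exact pow_le_one₀ (by simp) (hq.trans (by simp))
          _ = q ^ 2 * 2⁻¹ ^ a := by rw [mul_one]
    _ = 2 * q ^ 2 := by
        rw [ENNReal.tsum_mul_left, ENNReal.tsum_geometric, ENNReal.one_sub_inv_two, inv_inv,
          mul_comm]

/-- A bound for the mean of `log p * (∑ k < m, L k p - max_{k < m} L k p)`, where the `L k p` are
pairwise independent with geometric tails. -/
noncomputable def logExcessBound (m : ℕ) (p : Nat.Primes) : ℝ≥0∞ :=
  ENNReal.ofReal (Real.log p) * (m ^ 2 * (2 * ((p : ℝ≥0∞)⁻¹) ^ 2))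

/-- Since `log n ≤ 2 n^{1/2}`, the terms are dominated by a multiple of `n^{-3/2}`. -/
lemma tsum_logExcessBound_ne_top (m : ℕ) : ∑' p, logExcessBound m p ≠ ∞ := by
  have hs : Summable fun n : ℕ ↦ Real.log n / (n : ℝ) ^ 2 := by
    refine Summable.of_nonneg_of_le (fun n ↦ by positivity) (fun n ↦ ?_)
      ((Real.summable_nat_rpow_inv.2 (by norm_num : (1 : ℝ) < 3 / 2)).mul_left 2)
    rcases Nat.eq_zero_or_pos n with rfl | hn
    · simp
    have hn' : (0 : ℝ) < n := by exact_mod_cast hn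
    have h := Real.log_le_rpow_div hn'.le (by norm_num : (0 : ℝ) < 1 / 2)
    calc Real.log n / (n : ℝ) ^ 2 ≤ ((n : ℝ) ^ (1 / 2 : ℝ) / (1 / 2)) / (n : ℝ) ^ 2 := by gcongr
      _ = 2 * ((n : ℝ) ^ (1 / 2 : ℝ) / (n : ℝ) ^ (2 : ℝ)) := by
          rw [← Real.rpow_natCast]; push_cast; ring
      _ = 2 * ((n : ℝ) ^ (3 / 2 : ℝ))⁻¹ := by
          rw [← Real.rpow_sub hn', ← Real.rpow_neg hn'.le]; norm_num
  have heq (p : Nat.Primes) : logExcessBound m p =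
      (2 * m ^ 2 : ℝ≥0∞) * ENNReal.ofReal (Real.log p / (p : ℝ) ^ 2) := by
    have hp : (0 : ℝ) < p := by exact_mod_cast p.2.pos
    rw [div_eq_mul_inv, ENNReal.ofReal_mul (Real.log_natCast_nonneg _),
      ENNReal.ofReal_inv_of_pos (by positivity), ENNReal.ofReal_pow hp.le, ENNReal.ofReal_natCast,
      logExcessBound, ENNReal.inv_pow]
    ring
  simp_rw [heq]
  rw [ENNReal.tsum_mul_left]
  refine ENNReal.mul_ne_top (by finiteness) ?_
  have := (hs.comp_injective (Subtype.val_injective (p := Nat.Prime)))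
  exact this.tsum_ofReal_ne_top

lemma lintegral_enorm_log_mul_sup_sub_sum_le {Ω : Type*} [MeasurableSpace Ω] {P : Measure Ω}
    [IsProbabilityMeasure P] {p : Nat.Primes} {L : ℕ → Ω → ℕ} (hL : ∀ k, Measurable (L k))
    (hind : Pairwise fun i j ↦ IndepFun (L i) (L j) P)
    (htail : ∀ k a, P.real {ω | a ≤ L k ω} ≤ ((p : ℝ) ^ a)⁻¹) (m : ℕ) :
    ∫⁻ ω, ‖Real.log p * ((((range m).sup fun k ↦ L k ω : ℕ) : ℝ)
      - ∑ k ∈ range m, (L k ω : ℝ))‖ₑ ∂P ≤ logExcessBound m p := by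
  have hp : (0 : ℝ) < p := by exact_mod_cast p.2.pos
  have htail' (k a : ℕ) : P {ω | a ≤ L k ω} ≤ ((p : ℝ≥0∞)⁻¹) ^ a := by
    rw [← ofReal_measureReal]
    refine (ENNReal.ofReal_le_ofReal (htail k a)).trans_eq ?_
    rw [ENNReal.ofReal_inv_of_pos (by positivity), ENNReal.ofReal_pow hp.le,
      ENNReal.ofReal_natCast, ENNReal.inv_pow]
  have hpair {i j : ℕ} (hij : i < j) :
      ∫⁻ ω, ((min (L i ω) (L j ω) : ℕ) : ℝ≥0∞) ∂P ≤ 2 * ((p : ℝ≥0∞)⁻¹) ^ 2 :=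
    lintegral_min_le_of_geometric_tail (hL i) (hL j) (hind hij.ne)
      (ENNReal.inv_le_inv.2 (by exact_mod_cast p.2.two_le)) (htail' i) (htail' j)
  have hm (i j : ℕ) : Measurable fun ω ↦ ((min (L i ω) (L j ω) : ℕ) : ℝ≥0∞) :=
    measurable_from_top.comp ((hL i).min (hL j))
  calc _ ≤ ∫⁻ ω, ENNReal.ofReal (Real.log p) *
        ∑ j ∈ range m, ∑ i ∈ range j, ((min (L i ω) (L j ω) : ℕ) : ℝ≥0∞) ∂P := by
        refine lintegral_mono fun ω ↦ ?_
        rw [enorm_mul, Real.enorm_of_nonneg (Real.log_natCast_nonneg _), Real.enorm_eq_ofReal_abs]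
        gcongr
        refine (ENNReal.ofReal_le_ofReal (abs_sup_sub_sum_le_sum_min (fun k ↦ L k ω) m)).trans_eq ?_
        rw [ENNReal.ofReal_natCast]
        push_cast
        rfl
    _ = ENNReal.ofReal (Real.log p) *
        ∑ j ∈ range m, ∑ i ∈ range j, ∫⁻ ω, ((min (L i ω) (L j ω) : ℕ) : ℝ≥0∞) ∂P := by
        rw [lintegral_const_mul' _ _ (by simp), lintegral_finsetSum _ fun j _ ↦
          Finset.measurable_fun_sum _ fun i _ ↦ hm i j]
        simp_rw [lintegral_finsetSum _ fun i _ ↦ hm i _]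
    _ ≤ ENNReal.ofReal (Real.log p) *
        ∑ j ∈ range m, ∑ i ∈ range m, 2 * ((p : ℝ≥0∞)⁻¹) ^ 2 := by
        gcongr with j hj
        refine (Finset.sum_le_sum fun i hi ↦ hpair (Finset.mem_range.1 hi)).trans ?_
        exact Finset.sum_le_sum_of_subset (range_subset_range.2 (Finset.mem_range.1 hj).le)
    _ = logExcessBound m p := by
        simp [logExcessBound]
        ring

/-! ### Logarithms of integers and of their lcm as sums over primes. -/

lemma hasSum_log_mul_factorization (N : ℕ) :
    HasSum (fun p : Nat.Primes ↦ Real.log p * (N.factorization p : ℝ)) (Real.log N) := by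
  have h : HasSum (fun p : ℕ ↦ Real.log p * (N.factorization p : ℝ)) (Real.log N) := by
    rw [Real.log_nat_eq_sum_factorization, Finsupp.sum]
    simp_rw [mul_comm (Real.log _)]
    refine hasSum_sum_of_ne_finset_zero fun p hp ↦ ?_
    simp [Finsupp.notMem_support_iff.1 hp]
  refine (hasSum_subtype_iff_of_support_subset (s := {p : ℕ | p.Prime}) fun p hp ↦ ?_).2 h
  by_contra hp'
  exact hp (by simp [Nat.factorization_eq_zero_of_not_prime N hp'])

lemma hasSum_log_mul_sup_sub_sum_factorization {u : ℕ → ℕ} {m : ℕ}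
    (hu : ∀ k ∈ range m, u k ≠ 0) :
    HasSum (fun p : Nat.Primes ↦ Real.log p *
      ((((range m).sup fun k ↦ (u k).factorization p : ℕ) : ℝ)
        - ∑ k ∈ range m, ((u k).factorization p : ℝ)))
      (Real.log ((range m).lcm u : ℕ) - ∑ k ∈ range m, Real.log (u k)) := by
  convert! (hasSum_log_mul_factorization ((range m).lcm u)).sub
    (hasSum_sum fun k (_ : k ∈ range m) ↦ hasSum_log_mul_factorization (u k)) using 2 with p
  rw [Finset.factorization_lcm hu, mul_sub, mul_sum]

/-! ### Divisibility and size of a uniform random integer. -/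

section Uniform

variable {Ω : Type*} [MeasurableSpace Ω] {P : Measure Ω} [IsProbabilityMeasure P] {n : ℕ+}
  {U : Ω → ℕ}

lemma measureReal_preimage_finset_of_uniform (hU : Measurable U)
    (hlaw : ∀ k ∈ Finset.Icc 1 (n : ℕ), P.real {ω | U ω = k} = 1 / (n : ℝ)) {T : Finset ℕ}
    (hT : T ⊆ Finset.Icc 1 (n : ℕ)) : P.real (U ⁻¹' T) = #T / (n : ℝ) := by
  rw [← sum_measureReal_preimage_singleton T fun k _ ↦ hU (measurableSet_singleton k)]
  refine (Finset.sum_congr rfl fun k hk ↦ hlaw k (hT hk)).trans ?_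
  simp [div_eq_mul_inv]

lemma ae_mem_Icc_of_uniform (hU : Measurable U)
    (hlaw : ∀ k ∈ Finset.Icc 1 (n : ℕ), P.real {ω | U ω = k} = 1 / (n : ℝ)) :
    ∀ᵐ ω ∂P, U ω ∈ Finset.Icc 1 (n : ℕ) := by
  have h := measureReal_preimage_finset_of_uniform hU hlaw subset_rfl
  have hn : (n : ℝ) ≠ 0 := by exact_mod_cast n.ne_zero
  rw [Nat.card_Icc, Nat.add_sub_cancel, div_self hn, measureReal_def,
    ENNReal.toReal_eq_one_iff] at h
  exact (mem_ae_iff_prob_eq_one (hU (Finset.measurableSet _))).2 h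

lemma measureReal_of_uniform (hU : Measurable U)
    (hlaw : ∀ k ∈ Finset.Icc 1 (n : ℕ), P.real {ω | U ω = k} = 1 / (n : ℝ)) {s : Set ℕ}
    {T : Finset ℕ} (hT : ∀ k, k ∈ T ↔ k ∈ Finset.Icc 1 (n : ℕ) ∧ k ∈ s) :
    P.real {ω | U ω ∈ s} = #T / (n : ℝ) := by
  rw [← measureReal_preimage_finset_of_uniform hU hlaw fun k hk ↦ ((hT k).1 hk).1]
  refine measureReal_congr ?_
  filter_upwards [ae_mem_Icc_of_uniform hU hlaw] with ω hω
  refine propext ?_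
  change U ω ∈ s ↔ U ω ∈ T
  rw [hT]
  tauto

/-- There are `⌊n / p ^ a⌋` multiples of `p ^ a` up to `n`. The bound is free of `n`, which makes
the control of large primes uniform. -/
lemma measureReal_le_factorization_of_uniform_le (hU : Measurable U)
    (hlaw : ∀ k ∈ Finset.Icc 1 (n : ℕ), P.real {ω | U ω = k} = 1 / (n : ℝ)) (p : Nat.Primes)
    (a : ℕ) : P.real {ω | a ≤ (U ω).factorization p} ≤ ((p : ℝ) ^ a)⁻¹ := by
  have hn : (0 : ℝ) < n := by exact_mod_cast n.pos
  have h : P.real {ω | a ≤ (U ω).factorization p} = ((n / (p : ℕ) ^ a : ℕ) : ℝ) / n := by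
    rw [← Nat.Ioc_filter_dvd_card_eq_div]
    refine measureReal_of_uniform hU hlaw (s := {k | a ≤ k.factorization p}) fun k ↦ ?_
    simp only [Finset.mem_filter, Finset.mem_Ioc, Finset.mem_Icc, Set.mem_ofPred_eq,
      Nat.lt_iff_add_one_le, zero_add]
    exact and_congr_right fun hk ↦ p.2.pow_dvd_iff_le_factorization (by omega)
  rw [h, div_le_iff₀ hn]
  refine Nat.cast_div_le.trans_eq ?_
  push_cast
  ring

/-- Up to a null set the event says that `U ≤ e^{-c} n` and that the product of the prime powers
divides `U`, so its probability is a count of multiples. -/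
lemma measureReal_le_neg_log_of_uniform (hU : Measurable U)
    (hlaw : ∀ k ∈ Finset.Icc 1 (n : ℕ), P.real {ω | U ω = k} = 1 / (n : ℝ)) (c : ℝ≥0)
    (F : Finset Nat.Primes) (a : Nat.Primes → ℕ) :
    P.real {ω | c ≤ (-Real.log (U ω / n)).toNNReal ∧ ∀ p ∈ F, a p ≤ (U ω).factorization p} =
      ((⌊Real.exp (-c) * n⌋₊ / ∏ p ∈ F, (p : ℕ) ^ a p : ℕ) : ℝ) / n := by
  have hn : (0 : ℝ) < n := by exact_mod_cast n.pos
  rw [← Nat.Ioc_filter_dvd_card_eq_div]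
  refine measureReal_of_uniform hU hlaw (s := {k | c ≤ (-Real.log (k / n)).toNNReal ∧
    ∀ p ∈ F, a p ≤ k.factorization p}) fun k ↦ ?_
  have hle : k ≤ ⌊Real.exp (-c) * n⌋₊ → k ≤ n := fun h ↦ by
    refine h.trans (Nat.floor_le_of_le ?_)
    exact mul_le_of_le_one_left hn.le (Real.exp_le_one_iff.2 (by simp))
  simp only [Finset.mem_filter, Finset.mem_Ioc, Finset.mem_Icc, Set.mem_ofPred_eq]
  rcases Nat.eq_zero_or_pos k with rfl | hk
  · simp
  -- The case `k > n` is split off because `toNNReal` then truncates to 0, and `h1` would fail for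
  -- `c = 0`.
  by_cases hkn : k ≤ n
  swap
  · exact ⟨fun h ↦ absurd (hle h.1.2) hkn, fun h ↦ absurd h.1.2 hkn⟩
  have hk' : (0 : ℝ) < k := by exact_mod_cast hk
  have h1 : k ≤ ⌊Real.exp (-c) * n⌋₊ ↔ c ≤ (-Real.log (k / n)).toNNReal := by
    rw [Real.le_toNNReal_iff_coe_le, le_neg, Real.log_le_iff_le_exp (by positivity),
      div_le_iff₀ hn, Nat.le_floor_iff (by positivity)]
    rw [neg_nonneg]
    exact Real.log_nonpos (by positivity) ((div_le_one hn).2 (by exact_mod_cast hkn))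
  have h2 : (∏ p ∈ F, (p : ℕ) ^ a p) ∣ k ↔ ∀ p ∈ F, a p ≤ k.factorization p := by
    simp_rw [← fun p : Nat.Primes ↦ p.2.pow_dvd_iff_le_factorization (k := a p) hk.ne']
    refine ⟨fun h p hp ↦ (Finset.dvd_prod_of_mem _ hp).trans h, fun h ↦ ?_⟩
    refine Finset.prod_dvd_of_isRelPrime (fun p _ q _ hpq ↦ ?_) h
    exact Nat.coprime_iff_isRelPrime.1 (Nat.coprime_pow_primes _ _ p.2 q.2
      fun h ↦ hpq (Subtype.ext h))
  rw [h1, h2]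
  exact ⟨fun h ↦ ⟨⟨hk, hkn⟩, h.1.2, h.2⟩, fun h ↦ ⟨⟨hk, h.2.1⟩, h.2.2⟩⟩

end Uniform

lemma tendsto_floor_div_div (c : ℝ≥0) (F : Finset Nat.Primes) (a : Nat.Primes → ℕ) :
    Tendsto (fun n : ℕ+ ↦
      ((⌊Real.exp (-c) * n⌋₊ / ∏ p ∈ F, (p : ℕ) ^ a p : ℕ) : ℝ) / n) atTop
      (𝓝 (Real.exp (-c) * ∏ p ∈ F, ((p : ℝ) ^ a p)⁻¹)) := by
  have h := (tendsto_nat_floor_mul_div_atTop (R := ℝ)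
    (a := Real.exp (-c) * ∏ p ∈ F, ((p : ℝ) ^ a p)⁻¹) (by positivity)).comp
    (tendsto_natCast_atTop_atTop.comp tendsto_PNat_val_atTop_atTop)
  refine h.congr fun n ↦ ?_
  simp only [Function.comp_apply]
  -- The nested floors collapse into the floor of one multiple of `n`.
  rw [← Nat.floor_div_natCast]
  congr 3
  rw [Finset.prod_inv_distrib]
  push_cast
  ring

/-! ### The lcm functional and its restriction to finitely many primes. -/

/-- The negative logarithms of the sizes `u j` together with the exponents `L j p`, as one point of
a product of half-lines. -/
noncomputable def sizeExponents (u : ℕ → ℝ) (L : ℕ → Nat.Primes → ℕ) :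
    ℕ × Option Nat.Primes → ℝ≥0
  | (j, none) => (-Real.log (u j)).toNNReal
  | (j, some p) => L j p

/-- The contribution of the prime `p` to the logarithm of the quotient of the least common multiple
of `m` numbers by their product. -/
noncomputable def lcmTerm (y : ℕ × Option Nat.Primes → ℝ≥0) (m : ℕ) (p : Nat.Primes) : ℝ :=
  Real.log p * (((range m).sup fun k ↦ y (k, some p) : ℝ≥0) - ∑ k ∈ range m, (y (k, some p) : ℝ))

/-- The logarithm of the normalised least common multiple, computed from sizes and exponents. -/
noncomputable def logLcm (y : ℕ × Option Nat.Primes → ℝ≥0) (m : ℕ+) : ℝ :=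
  -∑ j ∈ range m, (y (j, none) : ℝ) + ∑' p, lcmTerm y m p

/-- The version of `logLcm` in which only the primes in `F` are taken into account. -/
noncomputable def logLcmOn (F : Finset Nat.Primes) (y : ℕ × Option Nat.Primes → ℝ≥0) (m : ℕ+) :
    ℝ :=
  -∑ j ∈ range m, (y (j, none) : ℝ) + ∑ p ∈ F, lcmTerm y m p

lemma continuous_lcmTerm (m : ℕ) (p : Nat.Primes) : Continuous fun y ↦ lcmTerm y m p := by
  have h : Continuous fun y : ℕ × Option Nat.Primes → ℝ≥0 ↦
      (range m).sup fun k ↦ y (k, some p) :=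
    Continuous.finset_sup_apply fun k _ ↦ continuous_apply _
  unfold lcmTerm
  fun_prop

lemma continuous_logLcmOn (F : Finset Nat.Primes) : Continuous (logLcmOn F) := by
  have h := continuous_lcmTerm
  refine continuous_pi fun m ↦ ?_
  unfold logLcmOn
  fun_prop

lemma measurable_logLcm : Measurable logLcm := by
  refine measurable_pi_lambda _ fun m ↦ ?_
  unfold logLcm
  refine Measurable.add (by fun_prop) ?_
  exact Measurable.tsum fun p ↦ (continuous_lcmTerm m p).measurable

lemma measurable_sizeExponents {Ω : Type*} [MeasurableSpace Ω] {u : ℕ → Ω → ℝ}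
    {L : ℕ → Nat.Primes → Ω → ℕ} (hu : ∀ j, Measurable (u j)) (hL : ∀ k p, Measurable (L k p)) :
    Measurable fun ω ↦ sizeExponents (u · ω) fun k p ↦ L k p ω := by
  refine measurable_pi_lambda _ fun i ↦ ?_
  rcases i with ⟨j, _ | p⟩
  · exact (hu j).log.neg.real_toNNReal
  · exact (measurable_from_top (f := fun k : ℕ ↦ (k : ℝ≥0))).comp (hL j p)

lemma lcmTerm_sizeExponents (u : ℕ → ℝ) (L : ℕ → Nat.Primes → ℕ) (m : ℕ) (p : Nat.Primes) :
    lcmTerm (sizeExponents u L) m p = Real.log p *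
      ((((range m).sup fun k ↦ L k p : ℕ) : ℝ) - ∑ k ∈ range m, (L k p : ℝ)) := by
  have h : ((range m).sup fun k ↦ (L k p : ℝ≥0)) = (((range m).sup fun k ↦ L k p : ℕ) : ℝ≥0) :=
    (Finset.apply_sup_eq_sup_comp (fun k : ℕ ↦ (k : ℝ≥0)) (fun a b ↦ Nat.cast_max a b)
      Nat.cast_zero).symm
  simp only [lcmTerm, sizeExponents, h, NNReal.coe_natCast]

/-- Under `hu` the truncation by `toNNReal` in `sizeExponents` loses nothing. -/
lemma logLcm_sizeExponents {u : ℕ → ℝ} {L : ℕ → Nat.Primes → ℕ} {m : ℕ+}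
    (hu : ∀ j ∈ range m, Real.log (u j) ≤ 0) :
    logLcm (sizeExponents u L) m = ∑ j ∈ range m, Real.log (u j) + ∑' p : Nat.Primes, Real.log p *
      ((((range m).sup fun k ↦ L k p : ℕ) : ℝ) - ∑ k ∈ range m, (L k p : ℝ)) := by
  simp_rw [logLcm, lcmTerm_sizeExponents, ← Finset.sum_neg_distrib]
  congr 1
  refine Finset.sum_congr rfl fun j hj ↦ ?_
  simp [sizeExponents, Real.coe_toNNReal _ (neg_nonneg.2 (hu j hj))]

/-- Since `x` has finite support and zero bounds are vacuous, a survival event is a finite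
conjunction grouped by the index `j`, the form to which independence applies. Exponents are
integers, hence the ceilings. -/
lemma exists_forall_le_sizeExponents_iff (x : ℕ × Option Nat.Primes →₀ ℝ≥0) :
    ∃ (J : Finset ℕ) (F : Finset Nat.Primes), ∀ u L, (∀ i, x i ≤ sizeExponents u L i) ↔
      ∀ j ∈ J, x (j, none) ≤ (-Real.log (u j)).toNNReal ∧ ∀ p ∈ F, ⌈x (j, some p)⌉₊ ≤ L j p := by
  classical
  refine ⟨x.support.image Prod.fst, Finset.eraseNone (x.support.image Prod.snd), fun u L ↦
    ⟨fun h j _ ↦ ⟨h (j, none), fun p _ ↦ Nat.ceil_le.2 (h (j, some p))⟩, fun h i ↦ ?_⟩⟩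
  by_cases hi : x i = 0
  · simp [hi]
  have hi' : i ∈ x.support := Finsupp.mem_support_iff.2 hi
  obtain ⟨h1, h2⟩ := h i.1 (Finset.mem_image_of_mem _ hi')
  rcases i with ⟨j, _ | p⟩
  · exact h1
  · exact Nat.ceil_le.1 (h2 p (Finset.mem_eraseNone.2 (Finset.mem_image_of_mem Prod.snd hi')))

lemma edist_logLcm_logLcmOn_le (F : Finset Nat.Primes) (y : ℕ × Option Nat.Primes → ℝ≥0)
    (m : ℕ+) :
    edist (logLcm y m) (logLcmOn F y m) ≤ ∑' p : {p // p ∉ F}, ‖lcmTerm y m p‖ₑ := by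
  -- If the tail is infinite the bound is trivial; otherwise the series converges absolutely and
  -- `tsum` may be split at `F`.
  by_cases h : ∑' p : {p // p ∉ F}, ‖lcmTerm y m p‖ₑ = ∞
  · simp [h]
  have hs : Summable fun p : {p // p ∉ F} ↦ lcmTerm y m p := by
    refine Summable.of_enorm ?_
    exact h
  have hs' : Summable fun p ↦ lcmTerm y m p := F.summable_compl_iff.1 hs
  rw [edist_eq_enorm_sub, logLcm, logLcmOn, add_sub_add_left_eq_sub,
    ← hs'.sum_add_tsum_subtype_compl F, add_sub_cancel_left]
  exact enorm_tsum_le_tsum_enorm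

/-! ### Mean control of the primes outside a finite set. -/

section GeometricTails

variable {Ω : Type*} [MeasurableSpace Ω] {P : Measure Ω} [IsProbabilityMeasure P]
  {L : ℕ → Nat.Primes → Ω → ℕ}

lemma lintegral_tsum_enorm_lcmTerm_le (hL : ∀ k p, Measurable (L k p))
    (hind : ∀ p, Pairwise fun i j ↦ IndepFun (L i p) (L j p) P)
    (htail : ∀ k p a, P.real {ω | a ≤ L k p ω} ≤ ((p : ℝ) ^ a)⁻¹) {u : ℕ → Ω → ℝ}
    (hu : ∀ j, Measurable (u j)) (m : ℕ) (s : Set Nat.Primes) :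
    ∫⁻ ω, ∑' p : s, ‖lcmTerm (sizeExponents (u · ω) fun k p ↦ L k p ω) m p‖ₑ ∂P ≤
      ∑' p : s, logExcessBound m p := by
  have hm (p : s) : Measurable fun ω ↦
      ‖lcmTerm (sizeExponents (u · ω) fun k p ↦ L k p ω) m p‖ₑ :=
    ((continuous_lcmTerm m p).measurable.comp (measurable_sizeExponents hu hL)).enorm
  rw [lintegral_tsum fun p ↦ (hm p).aemeasurable]
  simp_rw [lcmTerm_sizeExponents]
  exact ENNReal.tsum_le_tsum fun p ↦
    lintegral_enorm_log_mul_sup_sub_sum_le (fun k ↦ hL k p) (hind p) (fun k ↦ htail k p) m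

lemma lintegral_edist_logLcm_logLcmOn_le (hL : ∀ k p, Measurable (L k p))
    (hind : ∀ p, Pairwise fun i j ↦ IndepFun (L i p) (L j p) P)
    (htail : ∀ k p a, P.real {ω | a ≤ L k p ω} ≤ ((p : ℝ) ^ a)⁻¹) {u : ℕ → Ω → ℝ}
    (hu : ∀ j, Measurable (u j)) (F : Finset Nat.Primes) (m : ℕ+) :
    ∫⁻ ω, edist (logLcm (sizeExponents (u · ω) fun k p ↦ L k p ω) m)
      (logLcmOn F (sizeExponents (u · ω) fun k p ↦ L k p ω) m) ∂P ≤
      ∑' p : {p // p ∉ F}, logExcessBound m p :=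
  (lintegral_mono fun _ ↦ edist_logLcm_logLcmOn_le _ _ _).trans
    (lintegral_tsum_enorm_lcmTerm_le hL hind htail hu m {p | p ∉ F})

lemma ae_summable_log_mul_sup_sub_sum (hL : ∀ k p, Measurable (L k p))
    (hind : ∀ p, Pairwise fun i j ↦ IndepFun (L i p) (L j p) P)
    (htail : ∀ k p a, P.real {ω | a ≤ L k p ω} ≤ ((p : ℝ) ^ a)⁻¹) (m : ℕ) :
    ∀ᵐ ω ∂P, Summable fun p : Nat.Primes ↦ Real.log p *
      ((((range m).sup fun k ↦ L k p ω : ℕ) : ℝ) - ∑ k ∈ range m, (L k p ω : ℝ)) := by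
  -- The sizes do not enter `lcmTerm`, so a dummy `u` serves.
  have h := lintegral_tsum_enorm_lcmTerm_le hL hind htail (u := fun _ _ ↦ 0)
    (fun _ ↦ measurable_const) m Set.univ
  have hm : Measurable fun ω ↦ ∑' p : (Set.univ : Set Nat.Primes),
      ‖lcmTerm (sizeExponents (fun _ ↦ 0) fun k p ↦ L k p ω) m p‖ₑ :=
    Measurable.tsum fun p ↦ ((continuous_lcmTerm m p).measurable.comp
      (measurable_sizeExponents (fun _ ↦ measurable_const) hL)).enorm
  rw [tsum_univ fun p ↦ logExcessBound m p] at h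
  filter_upwards [ae_lt_top hm (h.trans_lt (tsum_logExcessBound_ne_top m).lt_top).ne] with ω hω
  rw [tsum_univ fun p ↦ ‖lcmTerm (sizeExponents (fun _ ↦ 0) fun k p ↦ L k p ω) m p‖ₑ] at hω
  have hs := Summable.of_enorm hω.ne
  exact hs.congr fun p ↦ lcmTerm_sizeExponents _ _ m p

end GeometricTails

/-! ### The joint limit law of sizes and exponents. -/

lemma measureReal_le_neg_log_of_isUniform {Ω : Type*} [MeasurableSpace Ω] {P : Measure Ω}
    {V : Ω → ℝ} (hV : pdf.IsUniform V (Set.Icc (0 : ℝ) 1) P volume) (c : ℝ≥0) :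
    P.real {ω | c ≤ (-Real.log (V ω)).toNNReal} = Real.exp (-c) := by
  have hA : MeasurableSet {v : ℝ | c ≤ (-Real.log v).toNNReal} :=
    measurableSet_le measurable_const (by fun_prop)
  have h := hV.measure_preimage (by simp) (by simp) hA
  have h' : (Set.Icc (0 : ℝ) 1 ∩ {v : ℝ | c ≤ (-Real.log v).toNNReal} : Set ℝ)
      =ᵐ[volume] Set.Icc 0 (Real.exp (-c)) := by
    -- The point 0 must go: by the convention `Real.log 0 = 0` it violates the equivalence when `c >
    -- 0`.
    filter_upwards [compl_mem_ae_iff.2 (Real.volume_singleton (a := 0))] with v hv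
    have hv0 : v ≠ 0 := hv
    refine propext ?_
    change (0 ≤ v ∧ v ≤ 1) ∧ c ≤ (-Real.log v).toNNReal ↔ 0 ≤ v ∧ v ≤ Real.exp (-c)
    rcases lt_or_ge v 0 with hneg | hnn
    · simp [hneg.not_ge]
    have hpos := lt_of_le_of_ne hnn hv0.symm
    have hexp : Real.exp (-c) ≤ 1 := Real.exp_le_one_iff.2 (by simp)
    by_cases h1 : v ≤ 1
    · rw [Real.le_toNNReal_iff_coe_le (neg_nonneg.2 (Real.log_nonpos hnn h1)), le_neg,
        Real.log_le_iff_le_exp hpos]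
      tauto
    · exact ⟨fun h ↦ absurd h.1.2 h1, fun h ↦ absurd (h.2.trans hexp) h1⟩
  rw [measure_congr h'] at h
  have h2 : P {ω | c ≤ (-Real.log (V ω)).toNNReal} = ENNReal.ofReal (Real.exp (-c)) := by
    simpa using h
  rw [measureReal_def, h2, ENNReal.toReal_ofReal (Real.exp_nonneg _)]

lemma iIndepFun.measureReal_biInter {Ω ι : Type*} [MeasurableSpace Ω] {P : Measure Ω}
    {β : ι → Type*} [∀ i, MeasurableSpace (β i)] {f : ∀ i, Ω → β i} (hf : iIndepFun f P)
    (J : Finset ι) {s : ∀ i, Set (β i)} (hs : ∀ i, MeasurableSet (s i)) :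
    P.real {ω | ∀ i ∈ J, f i ω ∈ s i} = ∏ i ∈ J, P.real {ω | f i ω ∈ s i} := by
  have h := hf.measure_inter_preimage_eq_mul J fun i _ ↦ hs i
  have h' : {ω | ∀ i ∈ J, f i ω ∈ s i} = ⋂ i ∈ J, f i ⁻¹' s i := by ext ω; simp
  rw [h', measureReal_def, h, ENNReal.toReal_prod]
  rfl

/-- Joint convergence of the survival functions of the sizes and the prime exponents of uniform
random integers. -/
lemma tendsto_measureReal_le_sizeExponents
    {Ω : ℕ+ → Type*} [∀ n, MeasurableSpace (Ω n)]
    (P : (n : ℕ+) → Measure (Ω n)) [∀ n, IsProbabilityMeasure (P n)]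
    (U : (n : ℕ+) → ℕ → Ω n → ℕ)
    (hU_meas : ∀ n j, Measurable (U n j))
    (hU_indep : ∀ n, iIndepFun (U n) (P n))
    (hU_law : ∀ (n : ℕ+) (j : ℕ), ∀ k ∈ Finset.Icc 1 (n : ℕ),
      (P n).real {ω | U n j ω = k} = 1 / (n : ℝ))
    {Ω' : Type*} [MeasurableSpace Ω'] (P' : Measure Ω') [IsProbabilityMeasure P']
    (V : ℕ → Ω' → ℝ)
    (hV_indep : iIndepFun V P')
    (hV_law : ∀ j, pdf.IsUniform (V j) (Set.Icc (0 : ℝ) 1) P' volume)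
    (G : ℕ → Nat.Primes → Ω' → ℕ)
    (hG_indep : iIndepFun (fun (i : ℕ × Nat.Primes) => G i.1 i.2) P')
    (hG_law : ∀ (k : ℕ) (p : Nat.Primes) (j : ℕ),
      P'.real {ω | j ≤ G k p ω} = ((p : ℝ) ^ j)⁻¹)
    (hVG : IndepFun (fun ω (j : ℕ) => V j ω) (fun ω (k : ℕ) (p : Nat.Primes) => G k p ω) P') :
    ∀ x : ℕ × Option Nat.Primes →₀ ℝ≥0, Tendsto (fun n : ℕ+ ↦ (P n).real {ω | ∀ i, x i ≤
      sizeExponents (fun j ↦ (U n j ω : ℝ) / n) (fun k p ↦ (U n k ω).factorization p) i}) atTop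
      (𝓝 (P'.real {ω | ∀ i, x i ≤ sizeExponents (V · ω) (fun k p ↦ G k p ω) i})) := by
  intro x
  obtain ⟨J, F, hx⟩ := exists_forall_le_sizeExponents_iff x
  simp_rw [hx]
  have hn (n : ℕ+) := iIndepFun.measureReal_biInter (hU_indep n) J
    (s := fun j ↦ {k | x (j, none) ≤ (-Real.log ((k : ℝ) / n)).toNNReal ∧
      ∀ p ∈ F, ⌈x (j, some p)⌉₊ ≤ k.factorization p}) fun _ ↦ MeasurableSet.of_discrete
  simp only [Set.mem_ofPred_eq] at hn
  simp_rw [hn, fun (n : ℕ+) j ↦ measureReal_le_neg_log_of_uniform (hU_meas n j) (hU_law n j)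
    (x (j, none)) F fun p ↦ ⌈x (j, some p)⌉₊]
  -- Independence within `V`, within `G` and between the two families gives exactly the product of
  -- the limits of the counts.
  have hlim : P'.real {ω | ∀ j ∈ J, x (j, none) ≤ (-Real.log (V j ω)).toNNReal ∧
      ∀ p ∈ F, ⌈x (j, some p)⌉₊ ≤ G j p ω} =
      ∏ j ∈ J, (Real.exp (-x (j, none)) * ∏ p ∈ F, ((p : ℝ) ^ ⌈x (j, some p)⌉₊)⁻¹) := by
    have hVJ := iIndepFun.measureReal_biInter hV_indep J
      (s := fun j ↦ {v | x (j, none) ≤ (-Real.log v).toNNReal})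
      fun j ↦ measurableSet_le measurable_const (by fun_prop)
    have hGJ := iIndepFun.measureReal_biInter hG_indep (J ×ˢ F)
      (s := fun i ↦ {k | ⌈x (i.1, some i.2)⌉₊ ≤ k}) fun _ ↦ MeasurableSet.of_discrete
    simp only [Set.mem_ofPred_eq, hG_law, fun j ↦ measureReal_le_neg_log_of_isUniform (hV_law j)]
      at hVJ hGJ
    have hprod := hVG.measure_inter_preimage_eq_mul
      {v | ∀ j ∈ J, x (j, none) ≤ (-Real.log (v j)).toNNReal}
      {g | ∀ i ∈ J ×ˢ F, ⌈x (i.1, some i.2)⌉₊ ≤ g i.1 i.2} ?_ ?_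
    · rw [Finset.prod_mul_distrib, ← Finset.prod_product', ← hVJ, ← hGJ, measureReal_def,
        measureReal_def, measureReal_def, ← ENNReal.toReal_mul]
      refine congrArg ENNReal.toReal (Eq.trans (congrArg P' ?_) hprod)
      ext ω
      simp only [Set.mem_ofPred_eq, Set.mem_inter_iff, Set.mem_preimage, Finset.mem_product,
        Prod.forall]
      exact ⟨fun h ↦ ⟨fun j hj ↦ (h j hj).1, fun j p hjp ↦ (h j hjp.1).2 p hjp.2⟩,
        fun h j hj ↦ ⟨h.1 j hj, fun p hp ↦ h.2 j p ⟨hj, hp⟩⟩⟩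
    · have : {v : ℕ → ℝ | ∀ j ∈ J, x (j, none) ≤ (-Real.log (v j)).toNNReal} =
          ⋂ j ∈ J, {v | x (j, none) ≤ (-Real.log (v j)).toNNReal} := by ext; simp
      rw [this]
      exact J.measurableSet_biInter fun j _ ↦ measurableSet_le measurable_const (by fun_prop)
    · have : {g : ℕ → Nat.Primes → ℕ | ∀ i ∈ J ×ˢ F, ⌈x (i.1, some i.2)⌉₊ ≤ g i.1 i.2} =
          ⋂ i ∈ J ×ˢ F, {g | ⌈x (i.1, some i.2)⌉₊ ≤ g i.1 i.2} := by ext; simp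
      rw [this]
      exact (J ×ˢ F).measurableSet_biInter fun i _ ↦
        measurableSet_le measurable_const (by fun_prop)
  rw [hlim]
  exact tendsto_finsetProd _ fun j _ ↦ tendsto_floor_div_div (x (j, none)) F _

/-! ### Convergence of the normalised lcm. -/

theorem proposition3p3
    -- for every `n ≥ 1`, an i.i.d. sequence `U n` with the uniform distribution on `{1, …, n}`
    {Ω : ℕ+ → Type*} [∀ n, MeasurableSpace (Ω n)]
    (P : (n : ℕ+) → Measure (Ω n)) [∀ n, IsProbabilityMeasure (P n)]
    (U : (n : ℕ+) → ℕ → Ω n → ℕ)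
    (hU_meas : ∀ n j, Measurable (U n j))
    (hU_indep : ∀ n, iIndepFun (U n) (P n))
    (hU_law : ∀ (n : ℕ+) (j : ℕ), ∀ k ∈ Finset.Icc 1 (n : ℕ),
      (P n).real {ω | U n j ω = k} = 1 / (n : ℝ))
    -- the probability space that carries the limit
    {Ω' : Type*} [MeasurableSpace Ω'] (P' : Measure Ω') [IsProbabilityMeasure P']
    -- an i.i.d. sequence `V` with the uniform distribution on `[0, 1]`
    (V : ℕ → Ω' → ℝ)
    (hV_meas : ∀ j, Measurable (V j))
    (hV_indep : iIndepFun V P')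
    (hV_law : ∀ j, pdf.IsUniform (V j) (Set.Icc (0 : ℝ) 1) P' volume)
    -- mutually independent geometric variables `G k p`, for `k : ℕ` and `p` prime
    (G : ℕ → Nat.Primes → Ω' → ℕ)
    (hG_meas : ∀ k p, Measurable (G k p))
    (hG_indep : iIndepFun (fun (i : ℕ × Nat.Primes) => G i.1 i.2) P')
    (hG_law : ∀ (k : ℕ) (p : Nat.Primes) (j : ℕ),
      P'.real {ω | j ≤ G k p ω} = ((p : ℝ) ^ j)⁻¹)
    -- the sequence `V` is independent of the whole family `G`
    (hVG : IndepFun (fun ω (j : ℕ) => V j ω) (fun ω (k : ℕ) (p : Nat.Primes) => G k p ω) P') :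
    -- the series over the primes converges (absolutely) almost surely, for all `m` ...
    (∀ᵐ ω ∂P', ∀ m : ℕ+, Summable (fun p : Nat.Primes =>
      Real.log (p : ℝ) * ((((range m).sup fun k => G k p ω : ℕ) : ℝ)
        - ∑ k ∈ range m, (G k p ω : ℝ)))) ∧
    -- ... and there is convergence in distribution in the product space, as `n → ∞`
    TendstoInDistribution
      (fun (n : ℕ+) (ω : Ω n) (m : ℕ+) =>
        Real.log (((range m).lcm fun j => U n j ω : ℕ) : ℝ) - (m : ℝ) * Real.log (n : ℝ))
      atTop
      (fun (ω : Ω') (m : ℕ+) =>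
        ∑ j ∈ range m, Real.log (V j ω)
          + ∑' p : Nat.Primes, Real.log (p : ℝ) *
              ((((range m).sup fun k => G k p ω : ℕ) : ℝ) - ∑ k ∈ range m, (G k p ω : ℝ)))
      P P' := by
  have hGind (p : Nat.Primes) : Pairwise fun i j ↦ IndepFun (G i p) (G j p) P' := fun i j hij ↦
    hG_indep.indepFun (i := (i, p)) (j := (j, p)) (by simpa using hij)
  have hGtail (k : ℕ) (p : Nat.Primes) (a : ℕ) : P'.real {ω | a ≤ G k p ω} ≤ ((p : ℝ) ^ a)⁻¹ :=
    (hG_law k p a).le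
  refine ⟨ae_all_iff.2 fun m ↦ ae_summable_log_mul_sup_sub_sum hG_meas hGind hGtail m, ?_⟩
  let L (n : ℕ+) (k : ℕ) (p : Nat.Primes) (ω : Ω n) : ℕ := (U n k ω).factorization p
  have hL (n : ℕ+) (k : ℕ) (p : Nat.Primes) : Measurable (L n k p) :=
    (measurable_from_top (f := fun N : ℕ ↦ N.factorization p)).comp (hU_meas n k)
  have hLind (n : ℕ+) (p : Nat.Primes) : Pairwise fun i j ↦ IndepFun (L n i p) (L n j p) (P n) :=
    fun i j hij ↦ ((hU_indep n).indepFun hij).comp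
      (measurable_from_top (f := fun N : ℕ ↦ N.factorization p))
      (measurable_from_top (f := fun N : ℕ ↦ N.factorization p))
  have hLtail (n : ℕ+) (k : ℕ) (p : Nat.Primes) (a : ℕ) :
      (P n).real {ω | a ≤ L n k p ω} ≤ ((p : ℝ) ^ a)⁻¹ :=
    measureReal_le_factorization_of_uniform_le (hU_meas n k) (hU_law n k) p a
  let Y (n : ℕ+) (ω : Ω n) := sizeExponents (fun j ↦ (U n j ω : ℝ) / n) fun k p ↦ L n k p ω
  let Z (ω : Ω') := sizeExponents (V · ω) fun k p ↦ G k p ω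
  have hU_div (n : ℕ+) (j : ℕ) : Measurable fun ω ↦ (U n j ω : ℝ) / n :=
    (measurable_from_top.comp (hU_meas n j)).div_const _
  have hY (n : ℕ+) : Measurable (Y n) := measurable_sizeExponents (hU_div n) (hL n)
  have hZ : Measurable Z := measurable_sizeExponents hV_meas hG_meas
  have hYZ : TendstoInDistribution Y atTop Z P P' :=
    tendstoInDistribution_of_tendsto_measureReal_le hY hZ
      (tendsto_measureReal_le_sizeExponents P U hU_meas hU_indep hU_law P' V hV_indep hV_law
        G hG_indep hG_law hVG)
  have key : TendstoInDistribution (fun n ω ↦ logLcm (Y n ω)) atTop (fun ω ↦ logLcm (Z ω)) P P' :=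
    tendstoInDistribution_pi_of_lintegral_edist_le (l' := atTop)
      (W := fun F n ω ↦ logLcmOn F (Y n ω)) (W' := fun F ω ↦ logLcmOn F (Z ω))
      (δ := fun F m ↦ ∑' p : {p // p ∉ F}, logExcessBound m p)
      (fun n ↦ (measurable_logLcm.comp (hY n)).aemeasurable)
      (measurable_logLcm.comp hZ).aemeasurable
      (fun F ↦ hYZ.continuous_comp (continuous_logLcmOn F))
      (fun m ↦ ENNReal.tendsto_tsum_compl_atTop_zero (tsum_logExcessBound_ne_top m))
      (fun F n m ↦ lintegral_edist_logLcm_logLcmOn_le (hL n) (hLind n) (hLtail n) (hU_div n) F m)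
      (fun F m ↦ lintegral_edist_logLcm_logLcmOn_le hG_meas hGind hGtail hV_meas F m)
  -- `logLcm` agrees with the stated variables only almost surely: nonpositive logarithms require `U
  -- n j ≤ n` and `V j ∈ [0, 1]`, and the factorization of the lcm requires `U n j ≠ 0`.
  refine key.congr (fun n ↦ ?_) ?_
  · filter_upwards [ae_all_iff.2 fun j ↦ ae_mem_Icc_of_uniform (hU_meas n j) (hU_law n j)] with ω hω
    have hn : (0 : ℝ) < n := by exact_mod_cast n.pos
    have hpos (j : ℕ) : (0 : ℝ) < U n j ω := by exact_mod_cast (Finset.mem_Icc.1 (hω j)).1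
    funext m
    rw [logLcm_sizeExponents fun j _ ↦ Real.log_nonpos (by positivity)
      ((div_le_one hn).2 (by exact_mod_cast (Finset.mem_Icc.1 (hω j)).2)),
      (hasSum_log_mul_sup_sub_sum_factorization fun k _ ↦ by exact_mod_cast (hpos k).ne').tsum_eq]
    simp_rw [fun j ↦ Real.log_div (hpos j).ne' hn.ne', Finset.sum_sub_distrib]
    simp
  · have hV01 : ∀ᵐ ω ∂P', ∀ j, V j ω ∈ Set.Icc (0 : ℝ) 1 := ae_all_iff.2 fun j ↦ by
      have := (hV_law j).measure_preimage (by simp) (by simp)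
        (measurableSet_Icc (a := (0 : ℝ)) (b := 1)).compl
      rw [Set.inter_compl_self] at this
      exact mem_ae_iff.2 (this.trans (by simp))
    filter_upwards [hV01] with ω hω
    funext m
    exact logLcm_sizeExponents fun j _ ↦ Real.log_nonpos (hω j).1 (hω j).2
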